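/- Let $\mathcal{L}_{\mathrm{or}} = \{+,-,\cdot,0,1,<\}$ be the first-order language of ordered rings. A real closure of an ordered field $(K,<)$ is an ordered field extension $(R,<)$ of $(K,<)$ such that $R$ is real closed and algebraic over $K$; it exists and is unique up to a unique order-preserving isomorphism over $K$, and is denoted by $K^{\mathrm{rc}}$. The field $K$ is said to be dense in $K^{\mathrm{rc}}$ if for all $a,b \in K^{\mathrm{rc}}$ with $a<b$ there is $c \in K$ such that $a<c<b$. Let $(K,<)$ and $(L,<)$ be ordered fields such that $(K,<) \equiv (L,<)$, i.e. $(K,<)$ and $(L,<)$ satisfy the same $\mathcal{L}_{\mathrm{or}}$-sentences. Suppose that $K$ is dense in $K^{\mathrm{rc}}$. Then $L$ is dense in $L^{\mathrm{rc}}$. -/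

import Mathlib

/-- The relation symbols of the language of ordered rings: a single binary symbol for `<`. -/
inductive OrderedRingRel : ℕ → Type
  | lt : OrderedRingRel 2

/-- The language of ordered rings `(+, ·, -, 0, 1, <)`. -/
def orderedRingLanguage : FirstOrder.Language where
  Functions := FirstOrder.ringFunc
  Relations := OrderedRingRel

/-- A type with ring operations and an order relation `<` (in particular an ordered field) as a
structure for the language of ordered rings, every symbol having its usual interpretation. -/
instance orderedRingStructure (K : Type*) [Add K] [Mul K] [Neg K] [Zero K] [One K] [LT K] :
    orderedRingLanguage.Structure K where
  funMap := fun {n} f =>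
    match n, f with
    | _, .add => fun x => x 0 + x 1
    | _, .mul => fun x => x 0 * x 1
    | _, .neg => fun x => -x 0
    | _, .zero => fun _ => 0
    | _, .one => fun _ => 1
  RelMap := fun {n} r =>
    match n, r with
    | _, .lt => fun x => x 0 < x 1

/-- `R` is a real closure of the ordered field `K`: an ordered field extension of `K` which is
real closed and algebraic over `K`. (Every ordered field has a real closure, and it is unique up to
a unique order-preserving isomorphism over `K`.) -/
structure IsRealClosure (K R : Type*)
    [Field K] [LinearOrder K] [IsStrictOrderedRing K]
    [Field R] [LinearOrder R] [IsStrictOrderedRing R] [Algebra K R] : Prop where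
  strictMono : StrictMono (algebraMap K R)
  isRealClosed : IsRealClosed R
  isAlgebraic : Algebra.IsAlgebraic K R

/-- The ordered field `K` is dense in its ordered extension field `R`: strictly between any two
elements of `R` there is an element of `K`. -/
def IsDenseInExtension (K R : Type*) [Field K] [Field R] [LinearOrder R] [Algebra K R] : Prop :=
  ∀ a b : R, a < b → ∃ c : K, a < algebraMap K R c ∧ algebraMap K R c < b

/-! Density in the real closure is equivalent to a first-order scheme, `HasApproxRoots`: positive
elements are approximately squares, and monic polynomials of odd degree take arbitrarily small
values. If `K` is dense, the scheme holds because the exact roots in the real closure can be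
approximated from `K` and polynomials are continuous. The scheme consists of sentences, so it passes
to `L`.

For the converse, let `C` be the closure of `L` in its real closure `R`. If a polynomial `F` from
the scheme, with coefficients in `C`, had no root in `C`, every root of `F` in `R` would keep a
positive distance from `L`. Over `R`, `F` is a product of constants, linear factors and definite
quadratics, so `|F|` would be bounded below on `L` by some `γ > 0`
(`IsRealClosed.exists_le_abs_eval`). Approximating the coefficients from `L` and applying the scheme
contradicts this. Hence `C` is real closed; as `R` is an ordered algebraic extension of `C`, `C =
R`, which is density. -/

/-! ### Irreducible polynomials over real closed fields -/

/-- In a finite Galois extension whose degree is a power of two, if the base field has no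
irreducible polynomials of degree two, then the extension is trivial. -/
theorem finrank_eq_one_of_two_pow {F N : Type*} [Field F] [Field N] [Algebra F N]
    [FiniteDimensional F N] [IsGalois F N] {m : ℕ} (hm : Module.finrank F N = 2 ^ m)
    (hF : ∀ f : Polynomial F, Irreducible f → f.natDegree ≠ 2) : Module.finrank F N = 1 := by
  rcases m with _ | m
  · simpa using hm
  exfalso
  have hcard : Nat.card (N ≃ₐ[F] N) = 2 ^ (m + 1) := by
    rw [IsGalois.card_aut_eq_finrank, hm]
  have : Fact (Nat.Prime 2) := ⟨Nat.prime_two⟩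
  -- A subgroup of index two has a quadratic extension of `F` as fixed field.
  obtain ⟨H, hH⟩ := Sylow.exists_subgroup_card_pow_prime (G := N ≃ₐ[F] N) 2 (n := m)
    (hcard ▸ pow_dvd_pow 2 (Nat.le_succ m))
  have h1 := IntermediateField.finrank_fixedField_eq_card H
  have h2 := Module.finrank_mul_finrank F (IntermediateField.fixedField H) N
  rw [h1, hH, hm, pow_succ, mul_comm] at h2
  have h3 : Module.finrank F (IntermediateField.fixedField H) = 2 :=
    Nat.eq_of_mul_eq_mul_left (by positivity) h2
  have hbot : IntermediateField.fixedField H ≠ ⊥ := by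
    intro h
    rw [h, IntermediateField.finrank_bot] at h3
    omega
  obtain ⟨β, hβ, hβ'⟩ : ∃ β ∈ IntermediateField.fixedField H, β ∉ (⊥ : IntermediateField F N) := by
    by_contra! h
    exact hbot (le_bot_iff.1 h)
  set γ : IntermediateField.fixedField H := ⟨β, hβ⟩
  have hint : IsIntegral F γ := IsIntegral.of_finite F γ
  have hdvd := minpoly.degree_dvd hint
  rw [h3, Nat.dvd_prime Nat.prime_two] at hdvd
  rcases hdvd with h | h
  · obtain ⟨y, hy⟩ := minpoly.natDegree_eq_one_iff.1 h
    refine hβ' (IntermediateField.mem_bot.2 ⟨y, ?_⟩)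
    exact congrArg Subtype.val hy
  · exact hF _ (minpoly.irreducible hint) h

/-- An irreducible polynomial over a field in which two is invertible and all elements are squares
is not quadratic. -/
theorem natDegree_ne_two_of_forall_isSquare {F : Type*} [Field F] [NeZero (2 : F)]
    (h : ∀ x : F, IsSquare x) (f : Polynomial F) (hf : Irreducible f) : f.natDegree ≠ 2 := by
  intro hd
  have ha : f.coeff 2 ≠ 0 := by
    rw [← hd]
    exact Polynomial.leadingCoeff_ne_zero.2 hf.ne_zero
  obtain ⟨x, hx⟩ := exists_quadratic_eq_zero (b := f.coeff 1) (c := f.coeff 0) ha (h _)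
  have hroot : f.IsRoot x := by
    rw [Polynomial.IsRoot, Polynomial.eval_eq_sum_range, hd]
    simp only [Finset.sum_range_succ, Finset.sum_range_zero]
    linear_combination hx
  have h1 : f.natDegree = 1 := Polynomial.natDegree_eq_of_degree_eq_some
    (Polynomial.degree_eq_one_of_irreducible_of_root hf hroot)
  omega

namespace IsRealClosed

variable {R : Type*} [Field R] [IsRealClosed R]

theorem natDegree_eq_one_of_irreducible_of_odd {f : Polynomial R} (hf : Irreducible f)
    (hodd : Odd f.natDegree) : f.natDegree = 1 := by
  obtain ⟨x, hx⟩ := exists_isRoot_of_odd_natDegree hodd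
  exact Polynomial.natDegree_eq_of_degree_eq_some
    (Polynomial.degree_eq_one_of_irreducible_of_root hf hx)

/-- A real closed field has no proper finite extensions of odd degree. -/
theorem finrank_eq_one_of_odd {E : Type*} [Field E] [Algebra R E]
    (hE : Odd (Module.finrank R E)) : Module.finrank R E = 1 := by
  have : FiniteDimensional R E := FiniteDimensional.of_finrank_pos hE.pos
  have key : ∀ x : E, x ∈ (⊥ : Subalgebra R E) := by
    intro x
    have hint : IsIntegral R x := IsIntegral.of_finite R x
    have h1 := natDegree_eq_one_of_irreducible_of_odd (minpoly.irreducible hint)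
      (hE.of_dvd_nat (minpoly.degree_dvd hint))
    obtain ⟨y, hy⟩ := minpoly.natDegree_eq_one_iff.1 h1
    exact Algebra.mem_bot.2 ⟨y, hy⟩
  exact Subalgebra.bot_eq_top_iff_finrank_eq_one.1 (top_unique fun x _ => key x)

/-- The degree of a finite Galois extension of a real closed field is a power of two. -/
theorem exists_finrank_eq_two_pow (N : Type*) [Field N] [Algebra R N] [FiniteDimensional R N]
    [IsGalois R N] : ∃ m : ℕ, Module.finrank R N = 2 ^ m := by
  have : Fact (Nat.Prime 2) := ⟨Nat.prime_two⟩
  -- The fixed field of `P` has degree equal to the index of `P`, which is odd, so it is trivial and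
  -- `P` is the whole group.
  let P : Sylow 2 (N ≃ₐ[R] N) := default
  have h1 := IntermediateField.finrank_fixedField_eq_card (P : Subgroup (N ≃ₐ[R] N))
  have h2 := Module.finrank_mul_finrank R (IntermediateField.fixedField (P : Subgroup (N ≃ₐ[R] N))) N
  have h3 := (P : Subgroup (N ≃ₐ[R] N)).card_mul_index
  rw [IsGalois.card_aut_eq_finrank, ← h2, h1, mul_comm] at h3
  have h4 := Nat.eq_of_mul_eq_mul_right Nat.card_pos h3
  have hodd : Odd (Module.finrank R (IntermediateField.fixedField (P : Subgroup (N ≃ₐ[R] N)))) := by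
    rw [← h4, ← Nat.not_even_iff_odd, even_iff_two_dvd]
    exact P.not_dvd_index
  rw [finrank_eq_one_of_odd hodd, one_mul, h1] at h2
  obtain ⟨m, hm⟩ := P.isPGroup'.exists_card_eq
  exact ⟨m, by rw [← h2]; exact hm⟩

variable [LinearOrder R] [IsStrictOrderedRing R]

/-- If `i` is a square root of `-1` in an extension of a real closed field `R`, then every element
of `R(i)` is a square in `R(i)`. -/
theorem isSquare_adjoin_sqrt_neg_one {N : Type*} [Field N] [Algebra R N] {i : N}
    (hi : i * i = -1) (z : IntermediateField.adjoin R {i}) : IsSquare z := by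
  have hint : IsIntegral R i := ⟨Polynomial.X ^ 2 + 1, by monicity!, by simp [pow_two, hi]⟩
  obtain ⟨z, hz⟩ := z
  have hz' := hz
  rw [← IntermediateField.mem_toSubalgebra,
    IntermediateField.adjoin_simple_toSubalgebra_of_isAlgebraic hint.isAlgebraic,
    Algebra.adjoin_singleton_eq_range_aeval] at hz'
  obtain ⟨p, rfl⟩ := hz'
  have hmon : (Polynomial.X ^ 2 + 1 : Polynomial R).Monic := by monicity!
  have hdeg : (p %ₘ (Polynomial.X ^ 2 + 1)).degree ≤ 1 := by
    have h1 := Polynomial.degree_modByMonic_lt p hmon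
    have h2 : (Polynomial.X ^ 2 + 1 : Polynomial R).degree = 2 := by compute_degree!
    rw [h2] at h1
    exact Order.le_of_lt_succ h1
  obtain ⟨a, b, hab⟩ : ∃ a b : R, Polynomial.aeval i p
      = algebraMap R N a + algebraMap R N b * i := by
    refine ⟨(p %ₘ (Polynomial.X ^ 2 + 1)).coeff 0, (p %ₘ (Polynomial.X ^ 2 + 1)).coeff 1, ?_⟩
    rw [← Polynomial.aeval_modByMonic_eq_self_of_root (q := Polynomial.X ^ 2 + 1)
      (by simp [pow_two, hi])]
    conv_lhs => rw [Polynomial.eq_X_add_C_of_degree_le_one hdeg]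
    simp
    ring
  -- The usual complex square root: with `s` the modulus of `a + bi`, take `x² = (s + a) / 2` and
  -- `y² = (s - a) / 2`, and choose the sign of `y` so that `2xy = b`.
  obtain ⟨x, y, hx, hy⟩ : ∃ x y : R, x * x - y * y = a ∧ 2 * x * y = b := by
    obtain ⟨s, hs⟩ := (nonneg_iff_isSquare (x := a * a + b * b)).1
      (add_nonneg (mul_self_nonneg a) (mul_self_nonneg b))
    wlog hs0 : 0 ≤ s generalizing s
    · exact this (-s) (by rw [hs]; ring) (by linarith)
    have hle : |a| ≤ s := abs_le_of_sq_le_sq (by nlinarith [mul_self_nonneg b]) hs0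
    obtain ⟨h1, h2⟩ := abs_le.1 hle
    obtain ⟨x, hx⟩ := (nonneg_iff_isSquare (x := (s + a) / 2)).1 (by linarith)
    obtain ⟨y, hy⟩ := (nonneg_iff_isSquare (x := (s - a) / 2)).1 (by linarith)
    have hsq : (2 * x * y) ^ 2 = b ^ 2 := by
      have : (2 * x * y) ^ 2 = 4 * (x * x) * (y * y) := by ring
      rw [this, ← hx, ← hy]
      linear_combination -hs
    rcases sq_eq_sq_iff_eq_or_eq_neg.1 hsq with h | h
    · exact ⟨x, y, by rw [← hx, ← hy]; ring, h⟩
    · exact ⟨x, -y, by rw [neg_mul_neg, ← hx, ← hy]; ring, by linear_combination -h⟩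
  have hmem : algebraMap R N x + algebraMap R N y * i ∈ IntermediateField.adjoin R {i} :=
    add_mem (IntermediateField.algebraMap_mem _ x)
      (mul_mem (IntermediateField.algebraMap_mem _ y) (IntermediateField.mem_adjoin_simple_self R i))
  refine ⟨⟨_, hmem⟩, Subtype.ext ?_⟩
  change Polynomial.aeval i p = _ * _
  rw [hab, ← hx, ← hy]
  simp only [map_sub, map_mul, map_ofNat]
  linear_combination (algebraMap R N y * algebraMap R N y) * -hi

/-- Irreducible polynomials over a real closed field have degree at most two. -/
theorem natDegree_le_two_of_irreducible {f : Polynomial R} (hf : Irreducible f) :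
    f.natDegree ≤ 2 := by
  -- The factor `X ^ 2 + 1` forces a square root of `-1` into the splitting field.
  let q : Polynomial R := f * (Polynomial.X ^ 2 + 1)
  have hmon : (Polynomial.X ^ 2 + 1 : Polynomial R).Monic := by monicity!
  have hq : q ≠ 0 := mul_ne_zero hf.ne_zero hmon.ne_zero
  let N := q.SplittingField
  have : IsGalois R N := ⟨⟩
  have hsplit : (q.map (algebraMap R N)).Splits := Polynomial.SplittingField.splits q
  have hsplit1 : (f.map (algebraMap R N)).Splits :=
    hsplit.of_dvd (Polynomial.map_ne_zero hq) (Polynomial.map_dvd _ (dvd_mul_right _ _))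
  have hsplit2 : ((Polynomial.X ^ 2 + 1 : Polynomial R).map (algebraMap R N)).Splits :=
    hsplit.of_dvd (Polynomial.map_ne_zero hq) (Polynomial.map_dvd _ (dvd_mul_left _ _))
  obtain ⟨i, hi⟩ := hsplit2.exists_eval_eq_zero (by
    rw [Polynomial.degree_map]
    have : (Polynomial.X ^ 2 + 1 : Polynomial R).degree = 2 := by compute_degree!
    rw [this]; decide)
  obtain ⟨α, hα⟩ := hsplit1.exists_eval_eq_zero (by
    rw [Polynomial.degree_map]; exact (Polynomial.degree_pos_of_irreducible hf).ne')
  have hi' : i * i = -1 := by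
    simp [pow_two] at hi
    linear_combination hi
  let C := IntermediateField.adjoin R {i}
  obtain ⟨m, hm⟩ := exists_finrank_eq_two_pow (R := R) N
  have htower := Module.finrank_mul_finrank R C N
  obtain ⟨k, -, hk⟩ := (Nat.dvd_prime_pow Nat.prime_two).1
    (hm ▸ Dvd.intro_left _ htower : Module.finrank C N ∣ 2 ^ m)
  have hone := finrank_eq_one_of_two_pow hk
    (natDegree_ne_two_of_forall_isSquare (isSquare_adjoin_sqrt_neg_one hi'))
  rw [hone, mul_one] at htower
  have hCdeg : Module.finrank R C ≤ 2 := by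
    have hint : IsIntegral R i := IsIntegral.of_finite R i
    rw [IntermediateField.adjoin.finrank hint]
    have hroot : Polynomial.aeval i (Polynomial.X ^ 2 + 1 : Polynomial R) = 0 := by
      simp [pow_two, hi']
    refine (Polynomial.natDegree_le_of_dvd (minpoly.dvd R i hroot) hmon.ne_zero).trans ?_
    compute_degree
  have hαroot : Polynomial.aeval α f = 0 := by
    rwa [Polynomial.aeval_def, ← Polynomial.eval_map]
  have hmin := minpoly.eq_of_irreducible hf hαroot
  have hnd : f.natDegree = (minpoly R α).natDegree := by
    rw [← hmin, Polynomial.natDegree_mul_C (inv_ne_zero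
      (Polynomial.leadingCoeff_ne_zero.2 hf.ne_zero))]
  rw [hnd]
  exact (minpoly.natDegree_le α).trans (htower ▸ hCdeg)

end IsRealClosed


/-! ### Approximate roots and bounds on polynomial values -/

/-- Approximate solvability of the equations defining real closed fields: positive elements are
approximately squares, and monic polynomials of odd degree have approximate zeros. -/
structure HasApproxRoots (K : Type*) [Field K] [LinearOrder K] : Prop where
  sqrt : ∀ a ε : K, 0 < a → 0 < ε → ∃ c, |c ^ 2 - a| < ε
  odd : ∀ n, Odd n → ∀ (a : Fin n → K) (ε : K), 0 < ε →
    ∃ c, |c ^ n + ∑ i, a i * c ^ (i : ℕ)| < ε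

/-- A Cauchy bound: monic polynomials are at least `1` outside a ball determined by the
coefficients. -/
theorem one_le_abs_of_one_add_sum_abs_le {R : Type*} [Field R] [LinearOrder R]
    [IsStrictOrderedRing R] {n : ℕ} (hn : 0 < n) (a : Fin n → R) {x : R}
    (hx : 1 + ∑ i, |a i| ≤ |x|) : 1 ≤ |x ^ n + ∑ i, a i * x ^ (i : ℕ)| := by
  obtain ⟨m, rfl⟩ : ∃ m, n = m + 1 := ⟨n - 1, by omega⟩
  have hs : 0 ≤ ∑ i, |a i| := Finset.sum_nonneg fun i _ => abs_nonneg _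
  have hx1 : 1 ≤ |x| := by linarith
  have hpow : 1 ≤ |x| ^ m := one_le_pow₀ hx1
  have h1 : |∑ i, a i * x ^ (i : ℕ)| ≤ (∑ i, |a i|) * |x| ^ m := by
    refine (Finset.abs_sum_le_sum_abs _ _).trans ?_
    rw [Finset.sum_mul]
    refine Finset.sum_le_sum fun i _ => ?_
    rw [abs_mul, abs_pow]
    exact mul_le_mul_of_nonneg_left (pow_le_pow_right₀ hx1 (by omega)) (abs_nonneg _)
  have h2 := abs_sub_abs_le_abs_add (x ^ (m + 1)) (∑ i, a i * x ^ (i : ℕ))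
  rw [abs_pow, pow_succ'] at h2
  -- The difference of absolute values is at least `|x| ^ m * (|x| - ∑ |a i|) ≥ |x| ^ m ≥ 1`.
  nlinarith

/-- A polynomial over a real closed field all of whose roots keep a positive distance from a set
is bounded away from zero on this set. -/
theorem IsRealClosed.exists_le_abs_eval {R : Type*} [Field R] [LinearOrder R]
    [IsStrictOrderedRing R] [IsRealClosed R] (A : Set R) (F : Polynomial R) (hF : F ≠ 0)
    (hroots : ∀ r, F.IsRoot r → ∃ ε > 0, ∀ x ∈ A, ε ≤ |x - r|) :
    ∃ γ > 0, ∀ x ∈ A, γ ≤ |F.eval x| := by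
  induction F using WfDvdMonoid.induction_on_irreducible with
  | zero => exact absurd rfl hF
  | unit u hu =>
    obtain ⟨c, hc, rfl⟩ := Polynomial.isUnit_iff.1 hu
    exact ⟨|c|, abs_pos.2 hc.ne_zero, fun x _ => by simp⟩
  | mul p q hp hq ih =>
    obtain ⟨γ₁, h₁, H₁⟩ := ih hp fun r hr => hroots r (by simp_all)
    replace hroots : ∀ r, q.IsRoot r → ∃ ε > 0, ∀ x ∈ A, ε ≤ |x - r| :=
      fun r hr => hroots r (by simp_all)
    suffices ∃ γ > 0, ∀ x ∈ A, γ ≤ |q.eval x| by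
      obtain ⟨γ₂, h₂, H₂⟩ := this
      refine ⟨γ₂ * γ₁, mul_pos h₂ h₁, fun x hx => ?_⟩
      rw [Polynomial.eval_mul, abs_mul]
      exact mul_le_mul (H₂ x hx) (H₁ x hx) h₁.le (abs_nonneg _)
    by_cases hex : ∃ r, q.IsRoot r
    · obtain ⟨r, hr⟩ := hex
      obtain ⟨ε, hε, H⟩ := hroots r hr
      have hdeg := Polynomial.degree_eq_one_of_irreducible_of_root hq hr
      have hlin := Polynomial.eq_X_add_C_of_degree_le_one hdeg.le
      have ha : q.coeff 1 ≠ 0 := Polynomial.coeff_ne_zero_of_eq_degree hdeg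
      rw [Polynomial.IsRoot, hlin] at hr
      simp only [Polynomial.eval_add, Polynomial.eval_mul, Polynomial.eval_C,
        Polynomial.eval_X] at hr
      refine ⟨|q.coeff 1| * ε, mul_pos (abs_pos.2 ha) hε, fun x hx => ?_⟩
      have : q.eval x = q.coeff 1 * (x - r) := by
        rw [hlin]
        simp
        linear_combination hr
      rw [this, abs_mul]
      exact mul_le_mul_of_nonneg_left (H x hx) (abs_nonneg _)
    · have heval : ∀ x, q.eval x = q.coeff 2 * (x * x) + q.coeff 1 * x + q.coeff 0 := by
        intro x
        rw [Polynomial.eval_eq_sum_range' (n := 3)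
          (Nat.lt_succ_of_le (natDegree_le_two_of_irreducible hq))]
        simp only [Finset.sum_range_succ, Finset.sum_range_zero]
        ring
      generalize q.coeff 2 = a, q.coeff 1 = b, q.coeff 0 = c at heval
      have ha : a ≠ 0 := by
        rintro rfl
        by_cases hb : b = 0
        · subst hb
          have hdeg := hq.natDegree_pos
          have : q = Polynomial.C c := Polynomial.funext fun x => by rw [heval]; simp
          rw [this, Polynomial.natDegree_C] at hdeg
          exact hdeg.false
        · exact hex ⟨-c / b, by rw [Polynomial.IsRoot, heval]; field_simp; ring⟩
      have hd : discrim a b c < 0 := by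
        by_contra! h
        obtain ⟨x, hx⟩ := exists_quadratic_eq_zero ha (IsSquare.of_nonneg h)
        exact hex ⟨x, by rw [Polynomial.IsRoot, heval, hx]⟩
      have ha4 : 0 < |4 * a| := abs_pos.2 (mul_ne_zero four_ne_zero ha)
      -- Completing the square: `4a * q(x) = (2ax + b)² - discrim a b c`.
      refine ⟨-discrim a b c / |4 * a|, div_pos (by linarith) ha4, fun x _ => ?_⟩
      rw [div_le_iff₀ ha4, ← abs_mul, heval]
      refine le_trans ?_ (le_abs_self _)
      rw [discrim]
      nlinarith [sq_nonneg (2 * a * x + b)]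

/-! ### The closure of a field in an ordered extension -/

section Closure

variable (L R : Type*) [Field L] [Field R] [LinearOrder R] [IsStrictOrderedRing R] [Algebra L R]

/-- The closure of a field in an ordered extension field, with respect to the order topology. -/
def fieldClosure : Subfield R :=
  letI : TopologicalSpace R := Preorder.topology R
  haveI : OrderTopology R := ⟨rfl⟩
  (algebraMap L R).fieldRange.topologicalClosure

variable {L R}

theorem mem_fieldClosure {x : R} :
    x ∈ fieldClosure L R ↔ ∀ ε > 0, ∃ c : L, |algebraMap L R c - x| < ε := by
  let _ : TopologicalSpace R := Preorder.topology R
  have : OrderTopology R := ⟨rfl⟩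
  change x ∈ closure ((algebraMap L R).fieldRange : Set R) ↔ _
  rw [mem_closure_iff_nhds_basis (nhds_basis_abs_sub_lt x)]
  simp

theorem algebraMap_mem_fieldClosure (c : L) : algebraMap L R c ∈ fieldClosure L R :=
  mem_fieldClosure.2 fun ε hε => ⟨c, by simpa using hε⟩

theorem exists_le_abs_sub_of_notMem_fieldClosure {x : R} (hx : x ∉ fieldClosure L R) :
    ∃ ε > 0, ∀ y ∈ Set.range (algebraMap L R), ε ≤ |y - x| := by
  rw [mem_fieldClosure] at hx
  push Not at hx
  obtain ⟨ε, hε, h⟩ := hx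
  exact ⟨ε, hε, by rintro _ ⟨c, rfl⟩; exact h c⟩

theorem IsDenseInExtension.exists_abs_eval_lt (hK : IsDenseInExtension L R) (p : Polynomial R)
    {r ε : R} (hr : p.IsRoot r) (hε : 0 < ε) :
    ∃ c : L, |p.eval (algebraMap L R c)| < ε := by
  let _ : TopologicalSpace R := Preorder.topology R
  have : OrderTopology R := ⟨rfl⟩
  have h := p.continuous.tendsto r
  rw [hr.eq_zero, (nhds_basis_abs_sub_lt r).tendsto_iff (nhds_basis_abs_sub_lt 0)] at h
  obtain ⟨η, hη, H⟩ := h ε hε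
  obtain ⟨c, h1, h2⟩ := hK (r - η) (r + η) (by linarith)
  refine ⟨c, ?_⟩
  simpa using H _ (abs_lt.2 ⟨by linarith, by linarith⟩ : |algebraMap L R c - r| < η)

end Closure

/-! ### Density and approximate roots -/

section Extension

variable {L R : Type*} [Field L] [LinearOrder L] [IsStrictOrderedRing L]
  [Field R] [LinearOrder R] [IsStrictOrderedRing R] [Algebra L R]

theorem StrictMono.algebraMap_abs (hmono : StrictMono (algebraMap L R)) (x : L) :
    algebraMap L R |x| = |algebraMap L R x| := by
  have h := hmono.monotone.map_max (a := x) (b := -x)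
  rwa [map_neg] at h

/-- An ordered field contains arbitrarily small positive elements of its algebraic ordered
extension fields. -/
theorem exists_pos_algebraMap_lt [Algebra.IsAlgebraic L R] (hmono : StrictMono (algebraMap L R))
    {ε : R} (hε : 0 < ε) : ∃ δ : L, 0 < δ ∧ algebraMap L R δ < ε := by
  -- The Cauchy bound for a monic equation of `ε⁻¹` over `L` lies in `L` and exceeds `ε⁻¹`; its
  -- inverse is the required `δ`.
  obtain ⟨p, hp, hroot⟩ := (Algebra.IsAlgebraic.isAlgebraic (R := L) ε⁻¹).isIntegral
  have hn : 0 < p.natDegree := by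
    rw [Nat.pos_iff_ne_zero]
    intro h
    rw [hp.natDegree_eq_zero.1 h] at hroot
    simp at hroot
  rw [Polynomial.eval₂_eq_sum_range, Finset.sum_range_succ, hp.coeff_natDegree, map_one, one_mul,
    ← Fin.sum_univ_eq_sum_range (fun i => algebraMap L R (p.coeff i) * ε⁻¹ ^ i), add_comm] at hroot
  have hlt : |ε⁻¹| < 1 + ∑ i : Fin p.natDegree, |algebraMap L R (p.coeff i)| := by
    by_contra! h
    have := one_le_abs_of_one_add_sum_abs_le hn _ h
    rw [hroot, abs_zero] at this
    exact not_le_of_gt one_pos this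
  have hM : (0 : L) < 1 + ∑ i : Fin p.natDegree, |p.coeff i| :=
    add_pos_of_pos_of_nonneg one_pos (Finset.sum_nonneg fun i _ => abs_nonneg _)
  refine ⟨(1 + ∑ i : Fin p.natDegree, |p.coeff i|)⁻¹, inv_pos.2 hM, ?_⟩
  rw [map_inv₀]
  refine inv_lt_of_inv_lt₀ hε ?_
  rw [map_add, map_one, map_sum]
  simp_rw [hmono.algebraMap_abs]
  exact (le_abs_self _).trans_lt hlt

theorem IsDenseInExtension.hasApproxRoots [IsRealClosed R] (hmono : StrictMono (algebraMap L R))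
    (hK : IsDenseInExtension L R) : HasApproxRoots L where
  sqrt a ε ha hε := by
    obtain ⟨r, hr⟩ : IsSquare (algebraMap L R a) :=
      IsSquare.of_nonneg (by simpa using hmono.monotone ha.le)
    obtain ⟨c, hc⟩ := hK.exists_abs_eval_lt (Polynomial.X ^ 2 - Polynomial.C (algebraMap L R a))
      (r := r) (ε := algebraMap L R ε) (by simp [hr, pow_two]) (by simpa using hmono hε)
    refine ⟨c, hmono.lt_iff_lt.1 ?_⟩
    rw [hmono.algebraMap_abs]
    simpa using hc
  odd n hn a ε hε := by
    set p : Polynomial R := Polynomial.X ^ n +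
      ∑ i : Fin n, Polynomial.C (algebraMap L R (a i)) * Polynomial.X ^ (i : ℕ)
    have hdeg : p.natDegree = n := by
      refine Polynomial.natDegree_eq_of_degree_eq_some ?_
      rw [Polynomial.degree_add_eq_left_of_degree_lt] <;> rw [Polynomial.degree_X_pow]
      exact Polynomial.degree_sum_fin_lt _
    obtain ⟨r, hr⟩ := IsRealClosed.exists_isRoot_of_odd_natDegree (f := p) (hdeg.symm ▸ hn)
    obtain ⟨c, hc⟩ := hK.exists_abs_eval_lt p (ε := algebraMap L R ε) hr
      (by simpa using hmono hε)
    refine ⟨c, hmono.lt_iff_lt.1 ?_⟩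
    rw [hmono.algebraMap_abs]
    simpa [p, Polynomial.eval_finsetSum] using hc

namespace HasApproxRoots

variable [IsRealClosed R] [Algebra.IsAlgebraic L R]

/-- Otherwise `X ^ 2 - x` would be bounded away from zero on `L`, against the approximate square
roots of an element of `L` close to `x`. -/
theorem exists_sq_eq (hL : HasApproxRoots L) (hmono : StrictMono (algebraMap L R)) {x : R}
    (hx : x ∈ fieldClosure L R) (hx0 : 0 < x) : ∃ r ∈ fieldClosure L R, r ^ 2 = x := by
  by_contra! hne
  set F : Polynomial R := Polynomial.X ^ 2 - Polynomial.C x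
  have hF : F ≠ 0 := Polynomial.X_pow_sub_C_ne_zero two_pos x
  obtain ⟨γ, hγ, H⟩ := IsRealClosed.exists_le_abs_eval (Set.range (algebraMap L R)) F hF
    fun r hr => exists_le_abs_sub_of_notMem_fieldClosure fun hmem =>
      hne r hmem (by simpa [F, sub_eq_zero] using hr)
  obtain ⟨δ, hδ, hδγ⟩ := exists_pos_algebraMap_lt hmono (half_pos hγ)
  -- Distance below `x` keeps `b` positive; the two errors, each below `γ / 2`, add up to less than
  -- `γ`.
  obtain ⟨b, hb⟩ := mem_fieldClosure.1 hx (min (γ / 2) x) (lt_min (half_pos hγ) hx0)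
  have hb1 := abs_lt.1 (hb.trans_le (min_le_left _ _))
  have hb2 := abs_lt.1 (hb.trans_le (min_le_right _ _))
  have hbpos : 0 < b := hmono.lt_iff_lt.1 (by rw [map_zero]; linarith)
  obtain ⟨c, hc⟩ := hL.sqrt b δ hbpos hδ
  have hc' := hmono hc
  rw [hmono.algebraMap_abs, map_sub, map_pow] at hc'
  obtain ⟨h1, h2⟩ := abs_lt.1 hc'
  refine not_lt_of_ge (H _ ⟨c, rfl⟩) ?_
  simp only [F, Polynomial.eval_sub, Polynomial.eval_pow, Polynomial.eval_X, Polynomial.eval_C]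
  exact abs_lt.2 ⟨by linarith, by linarith⟩

theorem exists_root_of_odd (hL : HasApproxRoots L) (hmono : StrictMono (algebraMap L R)) {n : ℕ}
    (hn : Odd n) (s : Fin n → R) (hs : ∀ i, s i ∈ fieldClosure L R) :
    ∃ r ∈ fieldClosure L R, r ^ n + ∑ i, s i * r ^ (i : ℕ) = 0 := by
  by_contra! hne
  set F : Polynomial R := Polynomial.X ^ n +
    ∑ i : Fin n, Polynomial.C (s i) * Polynomial.X ^ (i : ℕ)
  have heval : ∀ x, F.eval x = x ^ n + ∑ i, s i * x ^ (i : ℕ) := fun x => by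
    simp [F, Polynomial.eval_finsetSum]
  have hF : F ≠ 0 := (Polynomial.monic_X_pow_add (Polynomial.degree_sum_fin_lt s)).ne_zero
  obtain ⟨γ, hγ, H⟩ := IsRealClosed.exists_le_abs_eval (Set.range (algebraMap L R)) F hF
    fun r hr => exists_le_abs_sub_of_notMem_fieldClosure fun hmem =>
      hne r hmem (by rw [← heval]; exact hr)
  -- `B` will bound the approximate root `c`: the approximating coefficients satisfy `|b i| ≤ |s i|
  -- + 1`, so the Cauchy bound applies. `T` converts an error in the coefficients into one in the
  -- value at `c`.
  set B : R := 1 + ∑ i, (|s i| + 1)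
  have hB : 0 ≤ B := add_nonneg zero_le_one (Finset.sum_nonneg fun i _ => by positivity)
  set T : R := ∑ i : Fin n, B ^ (i : ℕ)
  have hT : 0 ≤ T := Finset.sum_nonneg fun i _ => pow_nonneg hB _
  -- `δ < 1` serves the Cauchy bound; `δ * (1 + T) < γ` covers the value error `δ` plus the
  -- coefficient error `δ * T`.
  obtain ⟨δ, hδ, hδγ⟩ := exists_pos_algebraMap_lt hmono
    (lt_min one_pos (div_pos hγ (by linarith : 0 < 1 + T)))
  set d := algebraMap L R δ
  have hd : 0 < d := by simpa [d] using hmono hδ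
  have hd1 : d < 1 := hδγ.trans_le (min_le_left _ _)
  have hd2 : d * (1 + T) < γ := (lt_div_iff₀ (by linarith)).1 (hδγ.trans_le (min_le_right _ _))
  choose b hb using fun i => mem_fieldClosure.1 (hs i) d hd
  obtain ⟨c, hc⟩ := hL.odd n hn b δ hδ
  have hc' := hmono hc
  rw [hmono.algebraMap_abs] at hc'
  simp only [map_add, map_pow, map_sum, map_mul] at hc'
  have hcB : |algebraMap L R c| ≤ B := by
    by_contra! h
    refine not_lt_of_ge (one_le_abs_of_one_add_sum_abs_le hn.pos _ (h.le.trans' ?_))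
      (hc'.trans hd1)
    refine add_le_add_right (Finset.sum_le_sum fun i _ => ?_) 1
    have := abs_sub_abs_le_abs_sub (algebraMap L R (b i)) (s i)
    linarith [hb i]
  refine not_lt_of_ge (H _ ⟨c, rfl⟩) ?_
  have hdiff : |∑ i, (s i - algebraMap L R (b i)) * algebraMap L R c ^ (i : ℕ)| ≤ d * T := by
    refine (Finset.abs_sum_le_sum_abs _ _).trans ?_
    rw [Finset.mul_sum]
    refine Finset.sum_le_sum fun i _ => ?_
    rw [abs_mul, abs_pow, abs_sub_comm]
    exact mul_le_mul (hb i).le (pow_le_pow_left₀ (abs_nonneg _) hcB _)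
      (pow_nonneg (abs_nonneg _) _) hd.le
  have hsplit : F.eval (algebraMap L R c) =
      (algebraMap L R c ^ n + ∑ i, algebraMap L R (b i) * algebraMap L R c ^ (i : ℕ)) +
      ∑ i, (s i - algebraMap L R (b i)) * algebraMap L R c ^ (i : ℕ) := by
    rw [heval]
    simp only [sub_mul, Finset.sum_sub_distrib]
    ring
  rw [hsplit]
  refine (abs_add_le _ _).trans_lt ?_
  linarith

theorem isRealClosed_fieldClosure (hL : HasApproxRoots L) (hmono : StrictMono (algebraMap L R)) :
    IsRealClosed (fieldClosure L R) := by
  refine IsRealClosed.of_linearOrderedField (fun {x} hx => ?_) (fun {f} hf => ?_)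
  · rcases hx.eq_or_lt with rfl | hx
    · exact IsSquare.zero
    · obtain ⟨r, hr, hrx⟩ := hL.exists_sq_eq hmono x.2 hx
      exact ⟨⟨r, hr⟩, Subtype.ext (by rw [← hrx]; exact pow_two r)⟩
  · have hf0 : f.leadingCoeff ≠ 0 := by
      rw [Polynomial.leadingCoeff_ne_zero]
      rintro rfl
      simp at hf
    -- The scheme concerns monic polynomials, so `f` is first divided by its leading coefficient.
    obtain ⟨r, hr, hroot⟩ := hL.exists_root_of_odd hmono hf
      (fun i => ((f.coeff i / f.leadingCoeff : fieldClosure L R) : R)) fun i => Subtype.property _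
    have hroot' : (⟨r, hr⟩ : fieldClosure L R) ^ f.natDegree +
        ∑ i : Fin f.natDegree, f.coeff i / f.leadingCoeff * ⟨r, hr⟩ ^ (i : ℕ) = 0 := by
      refine Subtype.ext ?_
      push_cast at hroot ⊢
      exact hroot
    refine ⟨⟨r, hr⟩, ?_⟩
    have := congrArg (f.leadingCoeff * ·) hroot'
    simp only [mul_add, Finset.mul_sum, mul_zero, ← mul_assoc, mul_div_cancel₀ _ hf0] at this
    rw [Polynomial.IsRoot, Polynomial.eval_eq_sum_range, Finset.sum_range_succ,
      ← Fin.sum_univ_eq_sum_range (fun i => f.coeff i * (⟨r, hr⟩ : fieldClosure L R) ^ i),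
      add_comm]
    exact this

/-- The minimal polynomial over the real closed closure has degree at most two, and a quadratic one
with a root in the ordered field `R` has nonnegative discriminant, hence is reducible. -/
theorem mem_fieldClosure_of_isAlgebraic (hL : HasApproxRoots L)
    (hmono : StrictMono (algebraMap L R)) (α : R) : α ∈ fieldClosure L R := by
  have := hL.isRealClosed_fieldClosure hmono
  have hint : IsIntegral (fieldClosure L R) α := by
    obtain ⟨p, hp, hroot⟩ := (Algebra.IsAlgebraic.isAlgebraic (R := L) α).isIntegral
    let φ : L →+* fieldClosure L R :=
      (algebraMap L R).codRestrict (fieldClosure L R) algebraMap_mem_fieldClosure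
    refine ⟨p.map φ, hp.map φ, ?_⟩
    rw [Polynomial.eval₂_map]
    exact hroot
  have hirr := minpoly.irreducible hint
  have hle := IsRealClosed.natDegree_le_two_of_irreducible hirr
  have hpos := hirr.natDegree_pos
  have hroot := minpoly.aeval (fieldClosure L R) α
  have hmonic := minpoly.monic hint
  generalize hf : minpoly (fieldClosure L R) α = f at *
  suffices f.natDegree = 1 by
    rw [← hf, minpoly.natDegree_eq_one_iff] at this
    obtain ⟨y, rfl⟩ := this
    exact y.2
  by_contra hne
  have h2 : f.natDegree = 2 := by omega
  have hc2 : f.coeff 2 = 1 := by rw [← h2]; exact hmonic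
  rw [Polynomial.aeval_eq_sum_range, h2] at hroot
  simp only [Finset.sum_range_succ, Finset.sum_range_zero, hc2, Algebra.smul_def] at hroot
  -- In `R` the discriminant is the square of `2 * α + f.coeff 1`.
  have hd : 0 ≤ discrim 1 (f.coeff 1) (f.coeff 0) := by
    have hsq : ((discrim 1 (f.coeff 1) (f.coeff 0) : fieldClosure L R) : R)
        = (2 * α + f.coeff 1) ^ 2 := by
      have h3 : ((f.coeff 0 : fieldClosure L R) : R) * 1 + f.coeff 1 * α + α ^ 2 = 0 := by
        simpa using! hroot
      rw [discrim]
      push_cast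
      have h4 : ((4 : fieldClosure L R) : R) = 4 := map_ofNat (fieldClosure L R).subtype 4
      linear_combination -4 * h3 - (f.coeff 0 : R) * h4
    refine Subtype.coe_le_coe.1 ?_
    rw [hsq]
    exact sq_nonneg _
  obtain ⟨x, hx⟩ := exists_quadratic_eq_zero one_ne_zero (IsSquare.of_nonneg hd)
  refine hne (Polynomial.natDegree_eq_of_degree_eq_some
    (Polynomial.degree_eq_one_of_irreducible_of_root hirr (x := x) ?_))
  rw [Polynomial.IsRoot, Polynomial.eval_eq_sum_range, h2]
  simp only [Finset.sum_range_succ, Finset.sum_range_zero, hc2]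
  linear_combination hx

theorem isDenseInExtension (hL : HasApproxRoots L) (hmono : StrictMono (algebraMap L R)) :
    IsDenseInExtension L R := by
  intro a b hab
  obtain ⟨c, hc⟩ := mem_fieldClosure.1 (hL.mem_fieldClosure_of_isAlgebraic hmono ((a + b) / 2))
    ((b - a) / 2) (by linarith)
  obtain ⟨h1, h2⟩ := abs_lt.1 hc
  exact ⟨c, by linarith, by linarith⟩

end HasApproxRoots

end Extension


/-! ### The scheme as first-order sentences -/

section Sentences

open FirstOrder Language

namespace OrderedRing

variable {α : Type} {n : ℕ}

/-- The sum of two terms in the language of ordered rings. -/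
def addTerm (s t : orderedRingLanguage.Term α) : orderedRingLanguage.Term α :=
  Functions.apply₂ (L := orderedRingLanguage) ringFunc.add s t

/-- The product of two terms in the language of ordered rings. -/
def mulTerm (s t : orderedRingLanguage.Term α) : orderedRingLanguage.Term α :=
  Functions.apply₂ (L := orderedRingLanguage) ringFunc.mul s t

/-- The negative of a term in the language of ordered rings. -/
def negTerm (t : orderedRingLanguage.Term α) : orderedRingLanguage.Term α :=
  Functions.apply₁ (L := orderedRingLanguage) ringFunc.neg t

/-- The constant `0` as a term in the language of ordered rings. -/
def zeroTerm : orderedRingLanguage.Term α :=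
  Constants.term (L := orderedRingLanguage) ringFunc.zero

/-- The constant `1` as a term in the language of ordered rings. -/
def oneTerm : orderedRingLanguage.Term α :=
  Constants.term (L := orderedRingLanguage) ringFunc.one

/-- The powers of a term in the language of ordered rings. -/
def powTerm (t : orderedRingLanguage.Term α) : ℕ → orderedRingLanguage.Term α
  | 0 => oneTerm
  | m + 1 => mulTerm (powTerm t m) t

/-- A finite sum of terms in the language of ordered rings. -/
def sumTerm : (m : ℕ) → (Fin m → orderedRingLanguage.Term α) → orderedRingLanguage.Term α
  | 0, _ => zeroTerm
  | m + 1, f => addTerm (sumTerm m fun i => f i.castSucc) (f (Fin.last m))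

/-- The formula `s < t` in the language of ordered rings. -/
def ltFormula (s t : orderedRingLanguage.Term (α ⊕ Fin n)) :
    orderedRingLanguage.BoundedFormula α n :=
  Relations.boundedFormula₂ (L := orderedRingLanguage) OrderedRingRel.lt s t

/-- The formula `|s| < t` in the language of ordered rings. -/
def absLtFormula (s t : orderedRingLanguage.Term (α ⊕ Fin n)) :
    orderedRingLanguage.BoundedFormula α n :=
  ltFormula (negTerm t) s ⊓ ltFormula s t

section Realize

variable {K : Type*} [Field K] [LinearOrder K] (v : α → K)

@[simp]
theorem realize_addTerm (s t : orderedRingLanguage.Term α) :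
    (addTerm s t).realize v = s.realize v + t.realize v :=
  Term.realize_functions_apply₂

@[simp]
theorem realize_mulTerm (s t : orderedRingLanguage.Term α) :
    (mulTerm s t).realize v = s.realize v * t.realize v :=
  Term.realize_functions_apply₂

@[simp]
theorem realize_negTerm (t : orderedRingLanguage.Term α) :
    (negTerm t).realize v = -t.realize v :=
  Term.realize_functions_apply₁

@[simp]
theorem realize_zeroTerm : (zeroTerm : orderedRingLanguage.Term α).realize v = 0 :=
  Term.realize_constants

@[simp]
theorem realize_oneTerm : (oneTerm : orderedRingLanguage.Term α).realize v = 1 :=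
  Term.realize_constants

@[simp]
theorem realize_powTerm (t : orderedRingLanguage.Term α) (m : ℕ) :
    (powTerm t m).realize v = t.realize v ^ m := by
  induction m with
  | zero => simp [powTerm]
  | succ m ih => simp [powTerm, ih, pow_succ]

@[simp]
theorem realize_sumTerm (m : ℕ) (f : Fin m → orderedRingLanguage.Term α) :
    (sumTerm m f).realize v = ∑ i, (f i).realize v := by
  induction m with
  | zero => simp [sumTerm]
  | succ m ih => simp [sumTerm, ih, Fin.sum_univ_castSucc]

@[simp]
theorem realize_ltFormula (s t : orderedRingLanguage.Term (α ⊕ Fin n)) (xs : Fin n → K) :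
    (ltFormula s t).Realize v xs ↔ s.realize (Sum.elim v xs) < t.realize (Sum.elim v xs) :=
  BoundedFormula.realize_rel₂

@[simp]
theorem realize_absLtFormula [IsStrictOrderedRing K]
    (s t : orderedRingLanguage.Term (α ⊕ Fin n)) (xs : Fin n → K) :
    (absLtFormula s t).Realize v xs ↔
      |s.realize (Sum.elim v xs)| < t.realize (Sum.elim v xs) := by
  simp [absLtFormula, abs_lt]

end Realize

/-- The sentence `∀ a ε, 0 < a → 0 < ε → ∃ c, |c ^ 2 - a| < ε`. -/
def approxSqrtSentence : orderedRingLanguage.Sentence :=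
  BoundedFormula.alls (n := 2)
    ((ltFormula zeroTerm (Term.var (Sum.inr 0))).imp
      ((ltFormula zeroTerm (Term.var (Sum.inr 1))).imp
        (BoundedFormula.ex (absLtFormula
          (addTerm (powTerm (Term.var (Sum.inr 2)) 2) (negTerm (Term.var (Sum.inr 0))))
          (Term.var (Sum.inr 1))))))

/-- The sentence `∀ a₀ … aₙ₋₁ ε, 0 < ε → ∃ c, |c ^ n + ∑ aᵢ * c ^ i| < ε`. -/
def approxRootSentence (n : ℕ) : orderedRingLanguage.Sentence :=
  -- Variables `0, …, n - 1` are the coefficients, `n` is `ε`, and `n + 1` is `c`.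
  BoundedFormula.alls (n := n + 1)
    ((ltFormula zeroTerm (Term.var (Sum.inr (Fin.last n)))).imp
      (BoundedFormula.ex (absLtFormula
        (addTerm (powTerm (Term.var (Sum.inr (Fin.last (n + 1)))) n)
          (sumTerm n fun i => mulTerm (Term.var (Sum.inr i.castSucc.castSucc))
            (powTerm (Term.var (Sum.inr (Fin.last (n + 1)))) i)))
        (Term.var (Sum.inr (Fin.last n).castSucc)))))

variable (K : Type*) [Field K] [LinearOrder K] [IsStrictOrderedRing K]

theorem realize_approxSqrtSentence : K ⊨ approxSqrtSentence ↔
    ∀ a ε : K, 0 < a → 0 < ε → ∃ c, |c ^ 2 - a| < ε := by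
  refine BoundedFormula.realize_alls.trans ?_
  -- Puts the indices in the form on which the `Fin.snoc` lemmas fire.
  have h0 : (0 : Fin 3) = (0 : Fin 2).castSucc := rfl
  have h1 : (1 : Fin 3) = (1 : Fin 2).castSucc := rfl
  have h2 : (2 : Fin 3) = Fin.last 2 := rfl
  simp only [BoundedFormula.realize_imp, BoundedFormula.realize_ex, realize_ltFormula,
    realize_absLtFormula, realize_addTerm, realize_negTerm, realize_powTerm, realize_zeroTerm,
    Term.realize_var, Sum.elim_inr, h0, h1, h2, Fin.snoc_castSucc, Fin.snoc_last, ← sub_eq_add_neg]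
  exact ⟨fun h a ε => h ![a, ε], fun h xs => h (xs 0) (xs 1)⟩

theorem realize_approxRootSentence (n : ℕ) : K ⊨ approxRootSentence n ↔
    ∀ (a : Fin n → K) (ε : K), 0 < ε → ∃ c, |c ^ n + ∑ i, a i * c ^ (i : ℕ)| < ε := by
  refine BoundedFormula.realize_alls.trans ?_
  simp only [BoundedFormula.realize_imp, BoundedFormula.realize_ex, realize_ltFormula,
    realize_absLtFormula, realize_addTerm, realize_mulTerm, realize_sumTerm, realize_powTerm,
    realize_zeroTerm, Term.realize_var, Sum.elim_inr, Fin.snoc_castSucc, Fin.snoc_last]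
  refine ⟨fun h a ε => ?_, fun h xs => h (fun i => xs i.castSucc) (xs (Fin.last n))⟩
  simpa using h (Fin.snoc a ε)

end OrderedRing

end Sentences

/-! ### Transfer along elementary equivalence -/

theorem HasApproxRoots.of_elementarilyEquivalent {K L : Type*}
    [Field K] [LinearOrder K] [IsStrictOrderedRing K]
    [Field L] [LinearOrder L] [IsStrictOrderedRing L]
    (h : orderedRingLanguage.ElementarilyEquivalent K L) (hK : HasApproxRoots K) :
    HasApproxRoots L where
  sqrt := (OrderedRing.realize_approxSqrtSentence L).1
    ((h.realize_sentence _).1 ((OrderedRing.realize_approxSqrtSentence K).2 hK.sqrt))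
  odd n hn := (OrderedRing.realize_approxRootSentence L n).1
    ((h.realize_sentence _).1 ((OrderedRing.realize_approxRootSentence K n).2 (hK.odd n hn)))

theorem mainTheorem2
    {K : Type*} [Field K] [LinearOrder K] [IsStrictOrderedRing K]
    {L : Type*} [Field L] [LinearOrder L] [IsStrictOrderedRing L]
    {RK : Type*} [Field RK] [LinearOrder RK] [IsStrictOrderedRing RK] [Algebra K RK]
    {RL : Type*} [Field RL] [LinearOrder RL] [IsStrictOrderedRing RL] [Algebra L RL]
    (hRK : IsRealClosure K RK) (hRL : IsRealClosure L RL)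
    (hKL : orderedRingLanguage.ElementarilyEquivalent K L)
    (hK : IsDenseInExtension K RK) :
    IsDenseInExtension L RL := by
  have := hRK.isRealClosed
  have := hRL.isRealClosed
  have := hRL.isAlgebraic
  exact ((hK.hasApproxRoots hRK.strictMono).of_elementarilyEquivalent hKL).isDenseInExtension
    hRL.strictMono
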